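/- **Model.** A typical receiver sits at a fixed point $y_0\in\mathbb R^2$; its transmitter $x_0$ is at distance $r_0>0$ from $y_0$ in a uniformly random direction. The remaining transmitters $\Phi_T\setminus\{x_0\}$ and the remaining receivers $\Phi_R\setminus\{y_0\}$ form homogeneous Poisson point processes (PPPs) on $\mathbb R^2$ of intensity $\lambda>0$, and the eavesdroppers form a homogeneous PPP $\Phi_E$ of intensity $\lambda_E>0$; these three processes and the direction of $x_0$ are independent. A link of length $r$ has status $k\in\{L,N\}$ (line of sight or not) with probability $p_L(r)=e^{-\beta r}$, $p_N(r)=1-e^{-\beta r}$, where $\beta>0$; its path loss is $r^{\alpha_k}$, where $0<\alpha_L<\alpha_N$, and given its status its channel gain $h$ is gamma distributed with shape $N_k$ and rate $N_k$, where $N_L>N_N\ge 1$ are integers. A sending node of type $t_1\in\{T,J\}$ (transmitter, jammer) has power $P_{t_1}>0$; a node of type $t\in\{T,J,R,W\}$ (also: receiver, wiretapper) has main-lobe width $\theta_t\in[0,2\pi]$ and main- and side-lobe gains $G_M^t,G_S^t>0$. Independently of its status and fading, a link from type $t_1\in\{T,J\}$ to type $t_2\in\{R,W\}$ has antenna gain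 $\mathsf G=G_i^{t_1}G_j^{t_2}$, $i,j\in\{M,S\}$, with probability $p^{t_1t_2}_{ij}=q_i(\theta_{t_1})q_j(\theta_{t_2})$, where $q_M(\theta)=\frac{\theta}{2\pi}$ and $q_S(\theta)=\frac{2\pi-\theta}{2\pi}$. Given all locations, the links from the transmitters $x\ne x_0$ to $y_0$ are independent with these laws, and each link from a transmitter to an eavesdropper or from an eavesdropper to a receiver has this law (no joint law of the latter links is needed). An eavesdropper wiretaps if its cost of wiretapping is less than $\rho$ times its cost of jamming ($\rho>0$), and jams otherwise. The cost of wiretapping (jamming) is the minimum over all transmitters (receivers) of the distance $d$ under the DOWJ attack, of the path loss $d^{\alpha}$ under the LOWJ attack, and of $d^{\alpha}/(P_T\mathsf G)$ (respectively $d^{\alpha}/(P_J\mathsf G)$) under the POWJ attack. Let $$I_{y_0}^T=\sum_{x\in\Phi_T\setminus\{x_0\}}P_T\,\mathsf G^{x,y_0}_{T,R}\,h_{x,y_0}\,d_{x,y_0}^{-\alpha}\in[0,\infty]$$ be the interference at $y_0$ from the other transmitters, let $\mathcal L_{y_0}^T(s)=\mathbb E[e^{-sI_{y_0}^T}]$ (with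 $e^{-\infty}=0$ and $0\cdot\infty=0$), and let $$\Omega_{T,R}(s,r)=\sum_{k\in\{L,N\}}\ \sum_{i,j\in\{M,S\}}p^{TR}_{ij}\,p_k(r)\left(1-\Big(1+\frac{sP_TG_i^TG_j^R}{N_kr^{\alpha_k}}\Big)^{-N_k}\right).$$ **Statement.** Under each of the DOWJ, LOWJ and POWJ attacks, for every $s\ge 0$, $$\mathcal L_{y_0}^T(s)=\exp\left(-2\pi\lambda\int_0^\infty\Omega_{T,R}(s,r)\,r\,dr\right),$$ where the integral of the nonnegative integrand takes its value in $[0,\infty]$. If $\alpha_N>2$, then moreover $I_{y_0}^T<\infty$ almost surely and the integral is finite for every $s\ge0$, so that this is an identity between ordinary real expressions. -/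

import Mathlib

open MeasureTheory ProbabilityTheory Set
open scoped ENNReal NNReal

noncomputable section

namespace OWJ

/-- The Euclidean plane. -/
abbrev Plane : Type := EuclideanSpace ℝ (Fin 2)

/-- Status of a link: line of sight or blocked. -/
inductive Status
  | LoS
  | NLoS
  deriving DecidableEq

/-- The two lobes of a sectored antenna. -/
inductive Lobe
  | main
  | side
  deriving DecidableEq

/-- Transmitting node types: (legitimate) transmitter or jammer. -/
inductive TxKind
  | T
  | J
  deriving DecidableEq

/-- Receiving node types: (legitimate) receiver or wiretapper. -/
inductive RxKind
  | R
  | W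
  deriving DecidableEq

/-- The three realizations of the opportunistic wiretapping and jamming attack. -/
inductive Attack
  | DOWJ
  | LOWJ
  | POWJ
  deriving DecidableEq

instance : Fintype Status := ⟨{Status.LoS, Status.NLoS}, fun k => by cases k <;> simp⟩
instance : Fintype Lobe := ⟨{Lobe.main, Lobe.side}, fun i => by cases i <;> simp⟩
instance : MeasurableSpace Status := ⊤
instance : MeasurableSpace Lobe := ⊤

/-- State of a link: (status, lobe used by the sender, lobe used by the addressee) and the
channel gain. -/
abbrev Link : Type := (Status × Lobe × Lobe) × ℝ

/-- Parameters of the network and their ranges. -/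
structure Params where
  /-- intensity of transmitters and of receivers -/
  lam : ℝ
  lam_pos : 0 < lam
  /-- intensity of eavesdroppers -/
  lamE : ℝ
  lamE_pos : 0 < lamE
  /-- distance of the typical transmitter-receiver pair -/
  r₀ : ℝ
  r₀_pos : 0 < r₀
  /-- blockage density -/
  beta : ℝ
  beta_pos : 0 < beta
  /-- bias of the eavesdroppers towards wiretapping -/
  rho : ℝ
  rho_pos : 0 < rho
  /-- transmit power and jamming power -/
  power : TxKind → ℝ
  power_pos : ∀ t, 0 < power t
  /-- main lobe width and antenna gains, sending nodes -/
  txWidth : TxKind → ℝ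
  txWidth_mem : ∀ t, txWidth t ∈ Icc 0 (2 * Real.pi)
  txGain : TxKind → Lobe → ℝ
  txGain_pos : ∀ t i, 0 < txGain t i
  /-- main lobe width and antenna gains, receiving nodes -/
  rxWidth : RxKind → ℝ
  rxWidth_mem : ∀ t, rxWidth t ∈ Icc 0 (2 * Real.pi)
  rxGain : RxKind → Lobe → ℝ
  rxGain_pos : ∀ t i, 0 < rxGain t i
  /-- path-loss exponents -/
  alpha : Status → ℝ
  alpha_pos : 0 < alpha Status.LoS
  alpha_lt : alpha Status.LoS < alpha Status.NLoS
  /-- Nakagami fading parameters -/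
  nak : Status → ℕ
  nak_pos : 0 < nak Status.NLoS
  nak_lt : nak Status.NLoS < nak Status.LoS

namespace Params

variable (p : Params)

/-- Probability that an isotropically oriented antenna with main lobe width `θ` shows the given
lobe. -/
def lobeProb (θ : ℝ) : Lobe → ℝ
  | Lobe.main => θ / (2 * Real.pi)
  | Lobe.side => (2 * Real.pi - θ) / (2 * Real.pi)

/-- The probability `p_{ij}^{t₁t₂}` of the antenna gain `G_i^{t₁} G_j^{t₂}`. -/
def gainProb (t₁ : TxKind) (t₂ : RxKind) (i j : Lobe) : ℝ :=
  lobeProb (p.txWidth t₁) i * lobeProb (p.rxWidth t₂) j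

/-- The probability `p_k(r)` that a link of length `r` has status `k`. -/
def statusProb (r : ℝ) : Status → ℝ
  | Status.LoS => Real.exp (-p.beta * r)
  | Status.NLoS => 1 - Real.exp (-p.beta * r)

/-- `Ω_{t₁,t₂}^{k,i,j}(s,r)`. -/
def OmegaKIJ (t₁ : TxKind) (t₂ : RxKind) (k : Status) (i j : Lobe) (s r : ℝ) : ℝ :=
  p.gainProb t₁ t₂ i j * p.statusProb r k *
    (1 - (1 + s * p.power t₁ * p.txGain t₁ i * p.rxGain t₂ j /
      (p.nak k * r ^ p.alpha k)) ^ (-(p.nak k : ℤ)))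

/-- `Ω_{t₁,t₂}^{k}(s,r)`. -/
def OmegaK (t₁ : TxKind) (t₂ : RxKind) (k : Status) (s r : ℝ) : ℝ :=
  ∑ i, ∑ j, p.OmegaKIJ t₁ t₂ k i j s r

/-- `Ω_{t₁,t₂}(s,r)`. -/
def Omega (t₁ : TxKind) (t₂ : RxKind) (s r : ℝ) : ℝ :=
  ∑ k, p.OmegaK t₁ t₂ k s r

/-- The law of the state of a link of length `d` from a node of type `t₁` to a node of type `t₂`:
status and lobes are independent, and given them the channel gain is gamma distributed with shape
and rate both equal to the Nakagami parameter of the status. -/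
def linkLaw (t₁ : TxKind) (t₂ : RxKind) (d : ℝ) : Measure Link :=
  ∑ k, ∑ i, ∑ j, ENNReal.ofReal (p.statusProb d k * p.gainProb t₁ t₂ i j) •
    (Measure.dirac (k, i, j)).prod (gammaMeasure (p.nak k) (p.nak k))

/-- Path loss `d ^ α` over distance `d` on a link in state `l`. -/
def pathLoss (d : ℝ) (l : Link) : ℝ := d ^ p.alpha l.1.1

/-- Effective antenna gain of a link in state `l`. -/
def antennaGain (t₁ : TxKind) (t₂ : RxKind) (l : Link) : ℝ :=
  p.txGain t₁ l.1.2.1 * p.rxGain t₂ l.1.2.2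

/-- Power received over distance `d` on a link in state `l`. -/
def receivedPower (t₁ : TxKind) (t₂ : RxKind) (d : ℝ) (l : Link) : ℝ :=
  p.power t₁ * p.antennaGain t₁ t₂ l * l.2 * d ^ (-p.alpha l.1.1)

end Params

/-- The random elements of the network around a typical pair `x₀ → y₀`. The typical receiver is at
the fixed point `y₀`; the transmitters other than `x₀`, the receivers other than `y₀` and the
eavesdroppers are enumerated by `ℕ`. In link families `none` stands for the member `x₀` or `y₀` of
the typical pair. -/
structure Network (Ω : Type*) where
  /-- location of the typical receiver -/
  y₀ : Plane
  /-- direction of the typical transmitter as seen from the typical receiver -/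
  angle : Ω → ℝ
  /-- locations of the other transmitters -/
  tx : ℕ → Ω → Plane
  /-- locations of the other receivers -/
  rx : ℕ → Ω → Plane
  /-- locations of the eavesdroppers -/
  eve : ℕ → Ω → Plane
  /-- links from the other transmitters to `y₀` -/
  linkTY : ℕ → Ω → Link
  /-- links from transmitters to eavesdroppers -/
  linkTE : Option ℕ → ℕ → Ω → Link
  /-- links from eavesdroppers to receivers -/
  linkER : ℕ → Option ℕ → Ω → Link

/-- The enumerated points `X 0, X 1, …` form a Poisson point process with intensity measure `ν`:
the number of points in a set of finite measure is Poisson distributed, and the numbers of points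
in finitely many pairwise disjoint such sets are independent. -/
structure IsPoissonProcess {Ω E : Type*} [MeasurableSpace Ω] [MeasurableSpace E]
    (P : Measure Ω) (ν : Measure E) (X : ℕ → Ω → E) : Prop where
  measurable : ∀ n, Measurable (X n)
  law : ∀ B : Set E, MeasurableSet B → ν B ≠ ∞ → ∀ k : ℕ,
    P {ω | {n | X n ω ∈ B}.encard = k} = poissonMeasure (ν B).toNNReal {k}
  indep : ∀ (m : ℕ) (B : Fin m → Set E), (∀ i, MeasurableSet (B i)) → (∀ i, ν (B i) ≠ ∞) →
    Pairwise (Function.onFun Disjoint B) →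
    iIndepFun (fun i ω => {n | X n ω ∈ B i}.encard) P

/-- Given the σ-algebra `m`, the random elements `Y i` are independent with laws `κ i ω`. -/
def IsCondIndepWithLaw {Ω ι M : Type*} {mΩ : MeasurableSpace Ω} [MeasurableSpace M]
    (P : Measure Ω) (m : MeasurableSpace Ω) (Y : ι → Ω → M) (κ : ι → Ω → Measure M) : Prop :=
  ∀ (F : Finset ι) (A : ι → Set M), (∀ i, MeasurableSet (A i)) →
    P⟦⋂ i ∈ F, Y i ⁻¹' A i | m⟧ =ᵐ[P] fun ω => ∏ i ∈ F, (κ i ω).real (A i)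

/-- Given the σ-algebra `m`, the random element `Y` has law `κ ω`. -/
def HasCondLaw {Ω M : Type*} {mΩ : MeasurableSpace Ω} [MeasurableSpace M]
    (P : Measure Ω) (m : MeasurableSpace Ω) (Y : Ω → M) (κ : Ω → Measure M) : Prop :=
  ∀ A : Set M, MeasurableSet A → P⟦Y ⁻¹' A | m⟧ =ᵐ[P] fun ω => (κ ω).real A

namespace Network

variable {Ω : Type*} (net : Network Ω) (p : Params)

/-- All transmitters; `none` is the typical one, at distance `r₀` from `y₀`. -/
def txAll : Option ℕ → Ω → Plane
  | none, ω => net.y₀ + !₂[p.r₀ * Real.cos (net.angle ω), p.r₀ * Real.sin (net.angle ω)]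
  | some n, ω => net.tx n ω

/-- All receivers; `none` is the typical one. -/
def rxAll : Option ℕ → Ω → Plane
  | none, _ => net.y₀
  | some n, ω => net.rx n ω

/-- All random locations together. -/
def locations (ω : Ω) : (((ℕ → Plane) × (ℕ → Plane)) × (ℕ → Plane)) × ℝ :=
  (((fun n => net.tx n ω, fun n => net.rx n ω), fun n => net.eve n ω), net.angle ω)

/-- The σ-algebra generated by all random locations. -/
abbrev locSigma : MeasurableSpace Ω := MeasurableSpace.comap net.locations inferInstance

/-- The cost of wiretapping for the eavesdropper `z`. -/
def wiretapCost (a : Attack) (z : ℕ) (ω : Ω) : ℝ :=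
  ⨅ x : Option ℕ,
    let d := dist (net.txAll p x ω) (net.eve z ω)
    let l := net.linkTE x z ω
    match a with
    | Attack.DOWJ => d
    | Attack.LOWJ => p.pathLoss d l
    | Attack.POWJ => p.pathLoss d l / (p.power TxKind.T * p.antennaGain TxKind.T RxKind.W l)

/-- The cost of jamming for the eavesdropper `z`. -/
def jamCost (a : Attack) (z : ℕ) (ω : Ω) : ℝ :=
  ⨅ y : Option ℕ,
    let d := dist (net.eve z ω) (net.rxAll y ω)
    let l := net.linkER z y ω
    match a with
    | Attack.DOWJ => d
    | Attack.LOWJ => p.pathLoss d l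
    | Attack.POWJ => p.pathLoss d l / (p.power TxKind.J * p.antennaGain TxKind.J RxKind.R l)

/-- The eavesdropper `z` wiretaps if wiretapping is cheaper than `ρ` times jamming, and jams
otherwise. -/
def IsJammer (a : Attack) (z : ℕ) (ω : Ω) : Prop :=
  ¬ net.wiretapCost p a z ω < p.rho * net.jamCost p a z ω

open Classical in
/-- The interference `I_{y₀}^{t}` at the typical receiver under the attack `a`: for `t = T` from
the transmitters other than `x₀`, for `t = J` from the jammers. -/
def interference (a : Attack) : TxKind → Ω → ℝ≥0∞
  | TxKind.T, ω => ∑' n, ENNReal.ofReal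
      (p.receivedPower TxKind.T RxKind.R (dist (net.tx n ω) net.y₀) (net.linkTY n ω))
  | TxKind.J, ω => ∑' z, if net.IsJammer p a z ω then ENNReal.ofReal
      (p.receivedPower TxKind.J RxKind.R (dist (net.eve z ω) net.y₀) (net.linkER z none ω)) else 0

/-- The probabilistic model of the network. Given all locations, the states of the links from the
interfering transmitters to `y₀` are independent and have the link law of their length; so has each
link to or from an eavesdropper, where no joint law is prescribed, since links of one eavesdropper
share its antenna. -/
structure IsModel [mΩ : MeasurableSpace Ω] (P : Measure Ω) : Prop where
  measurable_angle : Measurable net.angle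
  uniform_angle : pdf.IsUniform net.angle (Ioc 0 (2 * Real.pi)) P volume
  poisson_tx : IsPoissonProcess P (ENNReal.ofReal p.lam • volume) net.tx
  poisson_rx : IsPoissonProcess P (ENNReal.ofReal p.lam • volume) net.rx
  poisson_eve : IsPoissonProcess P (ENNReal.ofReal p.lamE • volume) net.eve
  indep_tx_rx : IndepFun (fun ω n => net.tx n ω) (fun ω n => net.rx n ω) P
  indep_eve : IndepFun (fun ω => (net.locations ω).1.1) (fun ω n => net.eve n ω) P
  indep_angle : IndepFun (fun ω => (net.locations ω).1) net.angle P
  measurable_linkTY : ∀ n, Measurable (net.linkTY n)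
  measurable_linkTE : ∀ x z, Measurable (net.linkTE x z)
  measurable_linkER : ∀ z y, Measurable (net.linkER z y)
  linkTY_law : IsCondIndepWithLaw P net.locSigma net.linkTY
    (fun n ω => p.linkLaw TxKind.T RxKind.R (dist (net.tx n ω) net.y₀))
  linkTE_law : ∀ x z, HasCondLaw P net.locSigma (net.linkTE x z)
    (fun ω => p.linkLaw TxKind.T RxKind.W (dist (net.txAll p x ω) (net.eve z ω)))
  linkER_law : ∀ z y, HasCondLaw P net.locSigma (net.linkER z y)
    (fun ω => p.linkLaw TxKind.J RxKind.R (dist (net.eve z ω) (net.rxAll y ω)))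

end Network

/-- `e ^ (-x)` for `x ∈ [0, ∞]`, with `e ^ (-∞) = 0`. -/
def expNeg (x : ℝ≥0∞) : ℝ := if x = ∞ then 0 else Real.exp (-x.toReal)

/-- The Laplace transform `s ↦ E[e ^ (-s X)]`, `s ≥ 0`, of a `[0, ∞]`-valued random variable. -/
def laplaceTransform {Ω : Type*} [MeasurableSpace Ω] (P : Measure Ω) (X : Ω → ℝ≥0∞) (s : ℝ) : ℝ :=
  ∫ ω, expNeg (ENNReal.ofReal s * X ω) ∂P

end OWJ

end

/-!
By the marking theorem, the interferers together with the states of their links to the receiver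
form a Poisson process on `Plane × Link`, so the Laplace functional of a Poisson process gives the
Laplace transform of the interference as `exp (-∫ (1 - exp (-s · power)))`, integrated over
locations and link states. The inner integral over the link state is `Ω(s, r)`, because the power
received on a link of fixed status and lobes is gamma distributed, and polar coordinates reduce the
outer integral to one over `r`. The marking theorem itself follows by integrating out the marks of
the first `N` points and letting `N → ∞`: the marks turn `exp (-u)` into another function with
values in `[0, 1]`, which is again of the form `exp (-v)`.

At infinity `Ω(s, r)` is of order `r ^ (-α_N)`, since the line-of-sight part decays exponentially;
this makes the integral finite when `α_N > 2`. Then the exponent vanishes as `s → 0`, and as `s → 0`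
the Laplace transform tends to the probability that the interference is finite.
-/

namespace OWJ

open Filter Topology

/-- The `[0, ∞]`-valued version of `expNeg`, for use under the Lebesgue integral. -/
noncomputable def eexpNeg (x : ℝ≥0∞) : ℝ≥0∞ := EReal.exp (-(x : EReal))

@[simp]
lemma eexpNeg_top : eexpNeg ∞ = 0 := by simp [eexpNeg]

@[simp]
lemma eexpNeg_zero : eexpNeg 0 = 1 := by simp [eexpNeg]

lemma eexpNeg_ofReal {x : ℝ} (hx : 0 ≤ x) :
    eexpNeg (ENNReal.ofReal x) = ENNReal.ofReal (Real.exp (-x)) := by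
  rw [eexpNeg, EReal.coe_ennreal_ofReal, max_eq_left hx, ← EReal.coe_neg, EReal.exp_coe]

lemma expNeg_ofReal {x : ℝ} (hx : 0 ≤ x) : expNeg (ENNReal.ofReal x) = Real.exp (-x) := by
  rw [expNeg, if_neg ENNReal.ofReal_ne_top, ENNReal.toReal_ofReal hx]

lemma expNeg_nonneg (x : ℝ≥0∞) : 0 ≤ expNeg x := by
  unfold expNeg
  split_ifs <;> positivity

lemma ofReal_expNeg (x : ℝ≥0∞) : ENNReal.ofReal (expNeg x) = eexpNeg x := by
  induction x with
  | top => simp [expNeg]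
  | coe x =>
    rw [← ENNReal.ofReal_coe_nnreal, expNeg_ofReal x.coe_nonneg, eexpNeg_ofReal x.coe_nonneg]

lemma toReal_eexpNeg (x : ℝ≥0∞) : (eexpNeg x).toReal = expNeg x := by
  rw [← ofReal_expNeg, ENNReal.toReal_ofReal (expNeg_nonneg x)]

lemma continuous_eexpNeg : Continuous eexpNeg :=
  ENNReal.continuous_exp.comp (continuous_neg.comp continuous_coe_ennreal_ereal)

@[fun_prop]
lemma measurable_eexpNeg : Measurable eexpNeg := continuous_eexpNeg.measurable

lemma antitone_eexpNeg : Antitone eexpNeg := fun _ _ h =>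
  EReal.exp_monotone (EReal.neg_le_neg_iff.2 (EReal.coe_ennreal_le_coe_ennreal_iff.2 h))

lemma eexpNeg_le_one (x : ℝ≥0∞) : eexpNeg x ≤ 1 :=
  eexpNeg_zero ▸ antitone_eexpNeg zero_le

lemma eexpNeg_add (x y : ℝ≥0∞) : eexpNeg (x + y) = eexpNeg x * eexpNeg y := by
  induction x with
  | top => simp
  | coe x =>
    induction y with
    | top => simp
    | coe y =>
      rw [← ENNReal.coe_add]
      simp_rw [← ENNReal.ofReal_coe_nnreal]
      rw [eexpNeg_ofReal (x + y).coe_nonneg, eexpNeg_ofReal x.coe_nonneg,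
        eexpNeg_ofReal y.coe_nonneg, ← ENNReal.ofReal_mul (Real.exp_pos _).le,
        NNReal.coe_add, neg_add, Real.exp_add]

lemma eexpNeg_sum {ι : Type*} (s : Finset ι) (f : ι → ℝ≥0∞) :
    eexpNeg (∑ i ∈ s, f i) = ∏ i ∈ s, eexpNeg (f i) := by
  induction s using Finset.cons_induction with
  | empty => simp
  | cons a s ha ih => rw [Finset.sum_cons, Finset.prod_cons, eexpNeg_add, ih]

lemma eexpNeg_mul_natCast (c : ℝ≥0∞) (k : ℕ) : eexpNeg (c * k) = eexpNeg c ^ k := by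
  simpa [mul_comm] using eexpNeg_sum (Finset.range k) fun _ => c

lemma eexpNeg_neg_log {g : ℝ≥0∞} (hg : g ≤ 1) : eexpNeg (-ENNReal.log g).toENNReal = g := by
  have log_nonpos : 0 ≤ -ENNReal.log g := by
    rw [EReal.neg_nonneg, ← ENNReal.log_one]
    exact ENNReal.log_monotone hg
  rw [eexpNeg, EReal.coe_toENNReal log_nonpos, neg_neg, ENNReal.exp_log]

section LaplaceTransform

variable {Ω : Type*} [MeasurableSpace Ω] {P : Measure Ω}

lemma lintegral_one_sub_eexpNeg [IsProbabilityMeasure P] {f : Ω → ℝ≥0∞} (hf : Measurable f) :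
    ∫⁻ ω, (1 - eexpNeg (f ω)) ∂P = 1 - ∫⁻ ω, eexpNeg (f ω) ∂P := by
  have hle : ∫⁻ ω, eexpNeg (f ω) ∂P ≤ 1 :=
    (lintegral_mono fun _ => eexpNeg_le_one _).trans (by simp)
  rw [lintegral_sub (by fun_prop) (ne_top_of_le_ne_top ENNReal.one_ne_top hle)
    (.of_forall fun _ => eexpNeg_le_one _), lintegral_one, measure_univ]

lemma tendsto_lintegral_prod_eexpNeg [IsFiniteMeasure P] {f : ℕ → Ω → ℝ≥0∞}
    (hf : ∀ n, Measurable (f n)) :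
    Tendsto (fun N => ∫⁻ ω, ∏ n ∈ Finset.range N, eexpNeg (f n ω) ∂P) atTop
      (𝓝 (∫⁻ ω, eexpNeg (∑' n, f n ω) ∂P)) := by
  simp_rw [← eexpNeg_sum]
  exact tendsto_lintegral_of_dominated_convergence 1 (fun N => by fun_prop)
    (fun N => .of_forall fun ω => eexpNeg_le_one _) (by simp)
    (.of_forall fun ω => (continuous_eexpNeg.tendsto _).comp (ENNReal.tendsto_nat_tsum _))

lemma ae_lt_top_of_tendsto_lintegral_eexpNeg [IsProbabilityMeasure P] {ι : Type*} {l : Filter ι}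
    [l.NeBot] {X : Ω → ℝ≥0∞} (hX : Measurable X) {c : ι → ℝ≥0∞} (hc : ∀ i, c i ≠ 0)
    (h : Tendsto (fun i => ∫⁻ ω, eexpNeg (c i * X ω) ∂P) l (𝓝 1)) : ∀ᵐ ω ∂P, X ω < ∞ := by
  have hset : MeasurableSet {ω | X ω < ∞} := measurableSet_lt hX measurable_const
  have hle (i : ι) : ∫⁻ ω, eexpNeg (c i * X ω) ∂P ≤ P {ω | X ω < ∞} := by
    rw [← lintegral_indicator_one hset]
    refine lintegral_mono fun ω => ?_
    by_cases hω : X ω < ∞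
    · simpa [hω] using eexpNeg_le_one _
    · simp [not_lt_top_iff.1 hω, ENNReal.mul_top (hc i)]
  exact (prob_compl_eq_zero_iff hset).2 (le_antisymm prob_le_one (le_of_tendsto' h hle))

lemma toReal_lintegral_eexpNeg {X : Ω → ℝ≥0∞} (hX : Measurable X) (s : ℝ) :
    (∫⁻ ω, eexpNeg (ENNReal.ofReal s * X ω) ∂P).toReal = laplaceTransform P X s := by
  have hm : Measurable fun ω => expNeg (ENNReal.ofReal s * X ω) := by
    simp_rw [← toReal_eexpNeg]
    fun_prop
  rw [laplaceTransform, integral_eq_lintegral_of_nonneg_ae (.of_forall fun _ => expNeg_nonneg _)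
    hm.aestronglyMeasurable]
  simp_rw [ofReal_expNeg]

lemma laplaceTransform_eq_integral_exp {X : Ω → ℝ≥0∞} (hX : ∀ᵐ ω ∂P, X ω < ∞) {s : ℝ}
    (hs : 0 ≤ s) : laplaceTransform P X s = ∫ ω, Real.exp (-s * (X ω).toReal) ∂P := by
  refine integral_congr_ae (hX.mono fun ω hω => ?_)
  dsimp only
  rw [← ENNReal.ofReal_toReal hω.ne, ← ENNReal.ofReal_mul hs, expNeg_ofReal (by positivity),
    ENNReal.ofReal_toReal hω.ne, neg_mul]

end LaplaceTransform

lemma lintegral_eexpNeg_poissonMeasure (r : ℝ≥0) (c : ℝ≥0∞) :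
    ∫⁻ k, eexpNeg (c * k) ∂(poissonMeasure r) = eexpNeg (r * (1 - eexpNeg c)) := by
  obtain ⟨q, hq0, hq1, hq⟩ : ∃ q : ℝ, 0 ≤ q ∧ q ≤ 1 ∧ eexpNeg c = ENNReal.ofReal q :=
    ⟨expNeg c, expNeg_nonneg c, ENNReal.ofReal_le_one.1 (ofReal_expNeg c ▸ eexpNeg_le_one c),
      (ofReal_expNeg c).symm⟩
  have pgf : HasSum (fun k : ℕ => q ^ k * (Real.exp (-r) * r ^ k / k.factorial))
      (Real.exp (-(r * (1 - q)))) := by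
    have h := (NormedSpace.expSeries_div_hasSum_exp (𝔸 := ℝ) (r * q)).mul_left (Real.exp (-r))
    rw [← Real.exp_eq_exp_ℝ, ← Real.exp_add] at h
    convert! h using 1
    · ext k
      rw [mul_pow]
      ring
    · congr 1
      ring
  have hr : (r : ℝ≥0∞) * (1 - ENNReal.ofReal q) = ENNReal.ofReal (r * (1 - q)) := by
    rw [ENNReal.ofReal_mul r.coe_nonneg, ENNReal.ofReal_sub _ hq0, ENNReal.ofReal_coe_nnreal,
      ENNReal.ofReal_one]
  rw [lintegral_countable', hq, hr, eexpNeg_ofReal (mul_nonneg r.coe_nonneg (sub_nonneg.2 hq1)),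
    ← pgf.tsum_eq, ENNReal.ofReal_tsum_of_nonneg (fun k => by positivity) pgf.summable]
  congr with k
  rw [eexpNeg_mul_natCast, hq, poissonMeasure_singleton, ENNReal.ofReal_mul (by positivity),
    ENNReal.ofReal_pow hq0]

lemma lintegral_eexpNeg_gammaMeasure {a b t : ℝ} (ha : 0 < a) (hb : 0 < b) (ht : 0 ≤ t) :
    ∫⁻ h, eexpNeg (ENNReal.ofReal (t * h)) ∂(gammaMeasure a b) =
      ENNReal.ofReal ((b / (b + t)) ^ a) := by
  have measurable_pdf (b : ℝ) : Measurable (gammaPDF a b) :=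
    (measurable_gammaPDFReal a b).ennreal_ofReal
  -- Tilting the density of rate `b` by `e ^ (-t h)` gives a multiple of that of rate `b + t`.
  have tilt (h : ℝ) : gammaPDF a b h * eexpNeg (ENNReal.ofReal (t * h)) =
      ENNReal.ofReal ((b / (b + t)) ^ a) * gammaPDF a (b + t) h := by
    rcases lt_or_ge h 0 with hh | hh
    · simp [gammaPDF_of_neg hh]
    rw [gammaPDF_of_nonneg hh, gammaPDF_of_nonneg hh, eexpNeg_ofReal (mul_nonneg ht hh),
      ← ENNReal.ofReal_mul' (Real.exp_pos _).le, ← ENNReal.ofReal_mul (by positivity)]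
    have hexp : Real.exp (-((b + t) * h)) = Real.exp (-(b * h)) * Real.exp (-(t * h)) := by
      rw [← Real.exp_add]
      congr 1
      ring
    have hpow : (b + t) ^ a ≠ 0 := (Real.rpow_pos_of_pos (by positivity) _).ne'
    rw [hexp, Real.div_rpow hb.le (by positivity)]
    congr 1
    field_simp
  rw [gammaMeasure, lintegral_withDensity_eq_lintegral_mul _ (measurable_pdf b) (by fun_prop)]
  simp_rw [Pi.mul_apply, tilt]
  rw [lintegral_const_mul _ (measurable_pdf _),
    lintegral_gammaPDF_eq_one ha (add_pos_of_pos_of_nonneg hb ht), mul_one]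

namespace IsPoissonProcess

variable {Ω E : Type*} [MeasurableSpace Ω] [MeasurableSpace E] {P : Measure Ω}
  {ν : Measure E} {X : ℕ → Ω → E}

lemma measurable_count (hX : IsPoissonProcess P ν X) {B : Set E} (hB : MeasurableSet B) :
    Measurable fun ω => {n | X n ω ∈ B}.encard :=
  measurable_encard.comp
    (measurable_set_iff.2 fun n => (measurable_mem.2 hB).comp (hX.measurable n))

lemma map_count [IsProbabilityMeasure P] (hX : IsPoissonProcess P ν X) {B : Set E}
    (hB : MeasurableSet B) (hν : ν B ≠ ∞) :
    P.map (fun ω => {n | X n ω ∈ B}.encard) =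
      (poissonMeasure (ν B).toNNReal).map (Nat.cast : ℕ → ℕ∞) := by
  have hm := hX.measurable_count hB
  have hcast : MeasurableEmbedding (Nat.cast : ℕ → ℕ∞) :=
    ⟨Nat.cast_injective, .of_discrete, fun _ _ => .of_discrete⟩
  have comap_count : poissonMeasure (ν B).toNNReal =
      (P.map fun ω => {n | X n ω ∈ B}.encard).comap (Nat.cast : ℕ → ℕ∞) := by
    refine Measure.ext_of_singleton fun k => ?_
    rw [hcast.comap_apply, image_singleton, Measure.map_apply hm .of_discrete,
      ← hX.law B hB hν k]
    rfl
  have := Measure.isProbabilityMeasure_map (μ := P) hm.aemeasurable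
  have := Measure.isProbabilityMeasure_map (μ := poissonMeasure (ν B).toNNReal)
    hcast.measurable.aemeasurable
  refine (Measure.eq_of_le_of_measure_univ_eq ?_ (by simp only [measure_univ])).symm
  rw [comap_count, hcast.map_comap]
  exact Measure.restrict_le_self

lemma lintegral_eexpNeg_count [IsProbabilityMeasure P] (hX : IsPoissonProcess P ν X) {B : Set E}
    (hB : MeasurableSet B) (hν : ν B ≠ ∞) (c : ℝ≥0∞) :
    ∫⁻ ω, eexpNeg (c * {n | X n ω ∈ B}.encard) ∂P = eexpNeg (ν B * (1 - eexpNeg c)) := by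
  have h := lintegral_eexpNeg_poissonMeasure (ν B).toNNReal c
  rw [ENNReal.coe_toNNReal hν] at h
  rw [← h, ← lintegral_map (f := fun k : ℕ∞ => eexpNeg (c * k)) .of_discrete
    (hX.measurable_count hB), hX.map_count hB hν, lintegral_map .of_discrete .of_discrete]
  simp

lemma lintegral_eexpNeg_sum_count [IsProbabilityMeasure P] (hX : IsPoissonProcess P ν X)
    {ι : Type*} [Fintype ι] {B : ι → Set E} (hB : ∀ i, MeasurableSet (B i))
    (hν : ∀ i, ν (B i) ≠ ∞) (hd : Pairwise (Function.onFun Disjoint B)) (c : ι → ℝ≥0∞) :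
    ∫⁻ ω, eexpNeg (∑ i, c i * {n | X n ω ∈ B i}.encard) ∂P =
      eexpNeg (∑ i, ν (B i) * (1 - eexpNeg (c i))) := by
  have e := Fintype.equivFin ι
  have indep_count : iIndepFun (fun i ω => {n | X n ω ∈ B i}.encard) P := by
    simpa using (hX.indep _ (B ∘ e.symm) (fun i => hB _) (fun i => hν _)
      (hd.comp_of_injective e.symm.injective)).precomp e.injective
  simp_rw [eexpNeg_sum, ← hX.lintegral_eexpNeg_count (hB _) (hν _)]
  refine lintegral_prod_eq_prod_lintegral_of_indepFun Finset.univ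
    (fun i ω => eexpNeg (c i * {n | X n ω ∈ B i}.encard))
    (indep_count.comp (fun i (k : ℕ∞) => eexpNeg (c i * k)) fun _ => .of_discrete) fun i => ?_
  exact (Measurable.of_discrete (f := fun k : ℕ∞ => eexpNeg (c i * k))).comp
    (hX.measurable_count (hB i))

lemma lintegral_eexpNeg_tsum_simpleFunc [IsProbabilityMeasure P] (hX : IsPoissonProcess P ν X)
    {f : SimpleFunc E ℝ≥0∞} (hf : f.FinMeasSupp ν) :
    ∫⁻ ω, eexpNeg (∑' n, f (X n ω)) ∂P = eexpNeg (∫⁻ x, (1 - eexpNeg (f x)) ∂ν) := by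
  let s := f.range.filter (· ≠ 0)
  have key := hX.lintegral_eexpNeg_sum_count (ι := s) (B := fun i => f ⁻¹' {(i : ℝ≥0∞)})
    (fun i => f.measurableSet_fiber _)
    (fun i => (SimpleFunc.finMeasSupp_iff.1 hf _ (Finset.mem_filter.1 i.2).2).ne)
    (fun i j hij => Disjoint.preimage _ (disjoint_singleton.2 (Subtype.coe_injective.ne hij)))
    (fun i => i)
  have lintegral_comp (μ : Measure E) (F : ℝ≥0∞ → ℝ≥0∞) (hF : F 0 = 0) :
      ∫⁻ x, F (f x) ∂μ = ∑ i : s, F i * μ (f ⁻¹' {(i : ℝ≥0∞)}) := by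
    rw [Finset.sum_coe_sort s fun i => F i * μ (f ⁻¹' {i}), Finset.sum_filter_of_ne,
      ← SimpleFunc.map_lintegral, ← SimpleFunc.lintegral_eq_lintegral]
    · rfl
    · rintro i - hi rfl
      simp [hF] at hi
  have tsum_eq (ω : Ω) :
      ∑' n, f (X n ω) = ∑ i : s, (i : ℝ≥0∞) * {n | X n ω ∈ f ⁻¹' {(i : ℝ≥0∞)}}.encard := by
    have hXω : Measurable fun n => X n ω := .of_discrete
    rw [← lintegral_count, ← lintegral_map f.measurable hXω]
    refine (lintegral_comp _ id rfl).trans ?_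
    refine Finset.sum_congr rfl fun i _ => ?_
    rw [Measure.map_apply hXω (f.measurableSet_fiber _), Measure.count_apply .of_discrete]
    rfl
  simp_rw [tsum_eq, key, lintegral_comp ν (1 - eexpNeg ·) (by simp), mul_comm]

end IsPoissonProcess

lemma exists_monotone_finMeasSupp_tendsto {E : Type*} [MeasurableSpace E] (ν : Measure E)
    [SigmaFinite ν] {u : E → ℝ≥0∞} (hu : Measurable u) :
    ∃ f : ℕ → SimpleFunc E ℝ≥0∞, (∀ k, (f k).FinMeasSupp ν) ∧ (∀ x, Monotone fun k => f k x) ∧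
      ∀ x, Tendsto (fun k => f k x) atTop (𝓝 (u x)) := by
  have restrict_apply (k : ℕ) (x : E) :
      (SimpleFunc.eapprox u k).restrict (spanningSets ν k) x =
        (spanningSets ν k).indicator (SimpleFunc.eapprox u k) x :=
    SimpleFunc.restrict_apply _ (measurableSet_spanningSets ν k) x
  refine ⟨fun k => (SimpleFunc.eapprox u k).restrict (spanningSets ν k), fun k => ?_,
    fun x i j hij => ?_, fun x => ?_⟩
  · rw [SimpleFunc.finMeasSupp_iff_support]
    refine (measure_mono fun x hx => ?_).trans_lt (measure_spanningSets_lt_top ν k)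
    exact of_not_not fun h => hx (by rw [restrict_apply, indicator_of_notMem h])
  · simp only [restrict_apply]
    exact (indicator_le_indicator (SimpleFunc.monotone_eapprox u hij x)).trans
      (indicator_le_indicator_of_subset (monotone_spanningSets ν hij) (fun _ => zero_le) x)
  · refine (SimpleFunc.tendsto_eapprox hu x).congr' ?_
    filter_upwards [eventually_ge_atTop (spanningSetsIndex ν x)] with k hk
    rw [restrict_apply, indicator_of_mem (mem_spanningSets_of_index_le ν x hk)]

/-- The enumerated points `X 0, X 1, …` have the Laplace functional
`u ↦ exp (-∫ (1 - exp (-u)) ∂ν)` of a Poisson point process with intensity measure `ν`.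
This characterizes such a process in law and, unlike `IsPoissonProcess`, is stated in a form that
passes to marked processes. -/
structure HasPoissonLaplaceFunctional {Ω E : Type*} [MeasurableSpace Ω] [MeasurableSpace E]
    (P : Measure Ω) (ν : Measure E) (X : ℕ → Ω → E) : Prop where
  measurable : ∀ n, Measurable (X n)
  lintegral_eexpNeg_tsum : ∀ u : E → ℝ≥0∞, Measurable u →
    ∫⁻ ω, eexpNeg (∑' n, u (X n ω)) ∂P = eexpNeg (∫⁻ x, (1 - eexpNeg (u x)) ∂ν)

theorem IsPoissonProcess.hasPoissonLaplaceFunctional {Ω E : Type*} [MeasurableSpace Ω]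
    [MeasurableSpace E] {P : Measure Ω} [IsProbabilityMeasure P] {ν : Measure E} [SigmaFinite ν]
    {X : ℕ → Ω → E} (hX : IsPoissonProcess P ν X) : HasPoissonLaplaceFunctional P ν X := by
  refine ⟨hX.measurable, fun u hu => ?_⟩
  obtain ⟨f, f_fin, f_mono, f_lim⟩ := exists_monotone_finMeasSupp_tendsto ν hu
  have lim_left : Tendsto (fun k => ∫⁻ ω, eexpNeg (∑' n, f k (X n ω)) ∂P) atTop
      (𝓝 (∫⁻ ω, eexpNeg (∑' n, u (X n ω)) ∂P)) := by
    refine tendsto_lintegral_of_dominated_convergence 1 (fun k => measurable_eexpNeg.comp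
      (Measurable.tsum fun n => (f k).measurable.comp (hX.measurable n)))
      (fun k => .of_forall fun ω => eexpNeg_le_one _) (by simp) (.of_forall fun ω => ?_)
    refine (continuous_eexpNeg.tendsto _).comp ?_
    simp_rw [← lintegral_count]
    exact lintegral_tendsto_of_tendsto_of_monotone (fun k => Measurable.of_discrete.aemeasurable)
      (.of_forall fun n => f_mono _) (.of_forall fun n => f_lim _)
  have lim_right : Tendsto (fun k => eexpNeg (∫⁻ x, (1 - eexpNeg (f k x)) ∂ν)) atTop
      (𝓝 (eexpNeg (∫⁻ x, (1 - eexpNeg (u x)) ∂ν))) := by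
    refine (continuous_eexpNeg.tendsto _).comp (lintegral_tendsto_of_tendsto_of_monotone
      (fun k => (measurable_const.sub (measurable_eexpNeg.comp (f k).measurable)).aemeasurable)
      (.of_forall fun x i j hij => tsub_le_tsub_left (antitone_eexpNeg (f_mono x hij)) _)
      (.of_forall fun x => ?_))
    exact ENNReal.Tendsto.sub tendsto_const_nhds ((continuous_eexpNeg.tendsto _).comp (f_lim x))
      (.inl ENNReal.one_ne_top)
  simp_rw [hX.lintegral_eexpNeg_tsum_simpleFunc (f_fin _)] at lim_left
  exact tendsto_nhds_unique lim_left lim_right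

theorem HasPoissonLaplaceFunctional.ae_tsum_lt_top {Ω E : Type*} [MeasurableSpace Ω]
    [MeasurableSpace E] {P : Measure Ω} [IsProbabilityMeasure P] {ν : Measure E} {X : ℕ → Ω → E}
    (hX : HasPoissonLaplaceFunctional P ν X) {f : E → ℝ≥0∞} (hf : Measurable f)
    (hf_top : ∀ x, f x ≠ ∞) (hf_int : ∫⁻ x, (1 - eexpNeg (f x)) ∂ν ≠ ∞) :
    ∀ᵐ ω ∂P, ∑' n, f (X n ω) < ∞ := by
  let c (k : ℕ) : ℝ≥0∞ := ((k + 1 : ℕ) : ℝ≥0∞)⁻¹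
  have c_le (k : ℕ) : c k ≤ 1 := ENNReal.inv_le_one.2 (by simp)
  have c_lim : Tendsto c atTop (𝓝 0) :=
    ENNReal.tendsto_inv_nat_nhds_zero.comp (tendsto_add_atTop_nat 1)
  have exponent_lim : Tendsto (fun k => ∫⁻ x, (1 - eexpNeg (c k * f x)) ∂ν) atTop (𝓝 0) := by
    rw [← lintegral_zero (μ := ν)]
    refine tendsto_lintegral_of_dominated_convergence (fun x => 1 - eexpNeg (f x))
      (fun k => by fun_prop) (fun k => .of_forall fun x => tsub_le_tsub_left
        (antitone_eexpNeg (mul_le_of_le_one_left zero_le (c_le k))) 1)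
      hf_int (.of_forall fun x => ?_)
    have h := (continuous_eexpNeg.tendsto _).comp
      (ENNReal.Tendsto.mul_const c_lim (.inr (hf_top x)))
    simpa [Function.comp_def] using
      ENNReal.Tendsto.sub tendsto_const_nhds h (.inl ENNReal.one_ne_top)
  refine ae_lt_top_of_tendsto_lintegral_eexpNeg (l := atTop) (c := c)
    (Measurable.tsum fun n => hf.comp (hX.measurable n))
    (fun k => ENNReal.inv_ne_zero.2 (ENNReal.natCast_ne_top _)) ?_
  simp_rw [← ENNReal.tsum_mul_left, fun k => hX.lintegral_eexpNeg_tsum _ (hf.const_mul (c k))]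
  simpa [Function.comp_def] using (continuous_eexpNeg.tendsto 0).comp exponent_lim

section Marking

variable {Ω D M : Type*} [MeasurableSpace D] [MeasurableSpace M] {κ : Kernel D M}
  [IsMarkovKernel κ]

/-- The kernel `x ↦ ⨂ i, κ (x i)` of independent draws from the laws `κ (x i)`. -/
noncomputable def piKernel (ι : Type*) [Fintype ι] (κ : Kernel D M) [IsMarkovKernel κ] :
    Kernel (ι → D) (ι → M) where
  toFun x := Measure.pi fun i => κ (x i)
  measurable' := by
    refine .measure_of_isPiSystem_of_isProbabilityMeasure generateFrom_pi.symm isPiSystem_pi ?_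
    rintro _ ⟨A, hA, rfl⟩
    simp_rw [Measure.pi_pi]
    exact Finset.measurable_fun_prod _ fun i _ =>
      (κ.measurable_coe (hA i (mem_univ i))).comp (measurable_pi_apply i)

instance (ι : Type*) [Fintype ι] : IsMarkovKernel (piKernel ι κ) :=
  ⟨fun x => inferInstanceAs (IsProbabilityMeasure (Measure.pi fun i => κ (x i)))⟩

lemma lintegral_prod_piKernel {ι : Type*} [Fintype ι] {φ : D × M → ℝ≥0∞} (hφ : Measurable φ)
    (x : ι → D) :
    ∫⁻ y, ∏ i, φ (x i, y i) ∂(piKernel ι κ x) = ∏ i, ∫⁻ y, φ (x i, y) ∂(κ (x i)) := by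
  have hφx (i : ι) : Measurable fun y => φ (x i, y) := hφ.comp measurable_prodMk_left
  have indep := iIndepFun_pi (μ := fun i => κ (x i)) (X := fun i y => φ (x i, y))
    fun i => (hφx i).aemeasurable
  refine (lintegral_prod_eq_prod_lintegral_of_indepFun Finset.univ _ indep
    fun i => (hφx i).comp (measurable_pi_apply i)).trans (Finset.prod_congr rfl fun i _ => ?_)
  exact (measurePreserving_eval (fun i => κ (x i)) i).lintegral_comp (hφx i)

namespace IsCondIndepWithLaw

variable {m mΩ : MeasurableSpace Ω} {P : Measure Ω} {ι : Type*}
  {Y : ι → Ω → M} {d : ι → Ω → D}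

lemma comp_injective {κ : ι → Ω → Measure M} (h : IsCondIndepWithLaw P m Y κ) {ι' : Type*}
    {e : ι' → ι} (he : Function.Injective e) :
    IsCondIndepWithLaw P m (fun i => Y (e i)) fun i => κ (e i) := by
  intro F A hA
  have hF := h (F.map ⟨e, he⟩) (Function.extend e A fun _ => univ) fun j => by
    by_cases hj : ∃ i, e i = j
    · obtain ⟨i, rfl⟩ := hj
      rw [he.extend_apply]
      exact hA i
    · rw [Function.extend_apply' _ _ _ hj]
      exact .univ
  simpa [he.extend_apply] using hF

lemma measure_inter [IsProbabilityMeasure P]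
    (h : IsCondIndepWithLaw P m Y fun i ω => κ (d i ω)) (hm : m ≤ mΩ)
    (hY : ∀ i, Measurable (Y i)) (S : Finset ι) {A : ι → Set M} (hA : ∀ i, MeasurableSet (A i))
    {C : Set Ω} (hC : MeasurableSet[m] C) :
    P ((⋂ i ∈ S, Y i ⁻¹' A i) ∩ C) = ∫⁻ ω in C, ∏ i ∈ S, κ (d i ω) (A i) ∂P := by
  have hE : MeasurableSet (⋂ i ∈ S, Y i ⁻¹' A i) :=
    S.measurableSet_biInter fun i _ => hY i (hA i)
  have condExp_ae := h S A hA
  have hint : Integrable (fun ω => ∏ i ∈ S, (κ (d i ω)).real (A i)) P :=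
    integrable_condExp.congr condExp_ae
  have real_measure_inter : ∫ ω in C, ∏ i ∈ S, (κ (d i ω)).real (A i) ∂P =
      P.real ((⋂ i ∈ S, Y i ⁻¹' A i) ∩ C) := by
    rw [← integral_congr_ae (ae_restrict_of_ae condExp_ae),
      setIntegral_condExp hm ((integrable_const 1).indicator hE) hC, integral_indicator hE,
      setIntegral_const, smul_eq_mul, mul_one, measureReal_restrict_apply hE]
  rw [← ofReal_measureReal, ← real_measure_inter,
    ofReal_integral_eq_lintegral_ofReal hint.integrableOn
      (.of_forall fun ω => Finset.prod_nonneg fun i _ => measureReal_nonneg)]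
  refine lintegral_congr fun ω => ?_
  rw [ENNReal.ofReal_prod_of_nonneg fun i _ => measureReal_nonneg]
  exact Finset.prod_congr rfl fun i _ => ofReal_measureReal

lemma map_prodMk [Fintype ι] [IsProbabilityMeasure P]
    (h : IsCondIndepWithLaw P m Y fun i ω => κ (d i ω)) (hm : m ≤ mΩ)
    (hY : ∀ i, Measurable (Y i)) (hd : ∀ i, Measurable[m] (d i)) :
    P.map (fun ω => (fun i => d i ω, fun i => Y i ω)) =
      P.map (fun ω i => d i ω) ⊗ₘ piKernel ι κ := by
  have hd_m : Measurable[m] fun ω i => d i ω := @measurable_pi_lambda _ _ _ m _ _ hd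
  have hd_pi := hd_m.mono hm le_rfl
  have hY_pi : Measurable fun ω i => Y i ω := measurable_pi_lambda _ hY
  have := Measure.isProbabilityMeasure_map (μ := P) hd_pi.aemeasurable
  have := Measure.isProbabilityMeasure_map (μ := P) (hd_pi.prodMk hY_pi).aemeasurable
  refine ext_of_generate_finite _ (generateFrom_eq_prod MeasurableSpace.generateFrom_measurableSet
    generateFrom_pi isCountablySpanning_measurableSet
    (.pi fun _ => isCountablySpanning_measurableSet)).symm
    (MeasurableSpace.isPiSystem_measurableSet.prod isPiSystem_pi) ?_ (by simp)
  rintro _ ⟨S, hS, _, ⟨A, hA, rfl⟩, rfl⟩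
  change MeasurableSet S at hS
  replace hA (i : ι) : MeasurableSet (A i) := hA i (mem_univ i)
  have box_preimage : (fun ω => (fun i => d i ω, fun i => Y i ω)) ⁻¹' (S ×ˢ pi univ A) =
      (⋂ i ∈ Finset.univ, Y i ⁻¹' A i) ∩ (fun ω i => d i ω) ⁻¹' S := by
    ext ω
    simp [and_comm]
  dsimp only
  rw [Measure.map_apply (hd_pi.prodMk hY_pi) (hS.prod (.univ_pi hA)), box_preimage,
    h.measure_inter hm hY _ hA (hd_m hS), Measure.compProd_apply_prod hS (.univ_pi hA),
    setLIntegral_map hS (Kernel.measurable_coe _ (.univ_pi hA)) hd_pi]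
  exact lintegral_congr fun ω => (Measure.pi_pi _ _).symm

lemma lintegral_prod [IsProbabilityMeasure P]
    (h : IsCondIndepWithLaw P m Y fun i ω => κ (d i ω)) (hm : m ≤ mΩ)
    (hY : ∀ i, Measurable (Y i)) (hd : ∀ i, Measurable[m] (d i)) {φ : D × M → ℝ≥0∞}
    (hφ : Measurable φ) (F : Finset ι) :
    ∫⁻ ω, ∏ i ∈ F, φ (d i ω, Y i ω) ∂P =
      ∫⁻ ω, ∏ i ∈ F, ∫⁻ y, φ (d i ω, y) ∂(κ (d i ω)) ∂P := by
  have hd_pi : Measurable fun ω (i : F) => d i ω :=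
    measurable_pi_lambda _ fun i => (hd i).mono hm le_rfl
  have hY_pi : Measurable fun ω (i : F) => Y i ω := measurable_pi_lambda _ fun i => hY i
  have hprod : Measurable fun q : (F → D) × (F → M) => ∏ i, φ (q.1 i, q.2 i) := by fun_prop
  have := Measure.isProbabilityMeasure_map (μ := P) hd_pi.aemeasurable
  simp_rw [← Finset.prod_coe_sort F]
  rw [← lintegral_map (f := fun q : (F → D) × (F → M) => ∏ i, φ (q.1 i, q.2 i)) hprod
    (hd_pi.prodMk hY_pi), (h.comp_injective Subtype.coe_injective).map_prodMk hm (fun i => hY i)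
    (fun i => hd i), Measure.lintegral_compProd hprod,
    lintegral_map hprod.lintegral_kernel_prod_right' hd_pi]
  exact lintegral_congr fun ω => lintegral_prod_piKernel hφ _

end IsCondIndepWithLaw

theorem HasPoissonLaplaceFunctional.prodMk {m mΩ : MeasurableSpace Ω} {P : Measure Ω}
    [IsProbabilityMeasure P] {ν : Measure D} [SFinite ν] {X : ℕ → Ω → D} {Y : ℕ → Ω → M}
    (hX : HasPoissonLaplaceFunctional P ν X) (hm : m ≤ mΩ) (hXm : ∀ n, Measurable[m] (X n))
    (hY : ∀ n, Measurable (Y n)) (h : IsCondIndepWithLaw P m Y fun n ω => κ (X n ω)) :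
    HasPoissonLaplaceFunctional P (ν ⊗ₘ κ) fun n ω => (X n ω, Y n ω) := by
  refine ⟨fun n => (hX.measurable n).prodMk (hY n), fun u hu => ?_⟩
  let ψ (x : D) : ℝ≥0∞ := ∫⁻ y, eexpNeg (u (x, y)) ∂(κ x)
  have hψ : Measurable ψ :=
    Measurable.lintegral_kernel_prod_right' (f := fun q => eexpNeg (u q)) (by fun_prop)
  have ψ_le_one (x : D) : ψ x ≤ 1 := (lintegral_mono fun _ => eexpNeg_le_one _).trans (by simp)
  let v (x : D) : ℝ≥0∞ := (-ENNReal.log (ψ x)).toENNReal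
  have hv : Measurable v := by fun_prop
  have eexpNeg_v (x : D) : eexpNeg (v x) = ψ x := eexpNeg_neg_log (ψ_le_one x)
  have integrate_marks (N : ℕ) :
      ∫⁻ ω, ∏ n ∈ Finset.range N, eexpNeg (u (X n ω, Y n ω)) ∂P =
        ∫⁻ ω, ∏ n ∈ Finset.range N, eexpNeg (v (X n ω)) ∂P := by
    simp_rw [eexpNeg_v]
    exact h.lintegral_prod hm hY hXm (φ := fun q => eexpNeg (u q)) (by fun_prop) _
  calc ∫⁻ ω, eexpNeg (∑' n, u (X n ω, Y n ω)) ∂P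
      = ∫⁻ ω, eexpNeg (∑' n, v (X n ω)) ∂P := by
        refine tendsto_nhds_unique (tendsto_lintegral_prod_eexpNeg fun n =>
          hu.comp ((hX.measurable n).prodMk (hY n))) ?_
        simp_rw [integrate_marks]
        exact tendsto_lintegral_prod_eexpNeg fun n => hv.comp (hX.measurable n)
    _ = eexpNeg (∫⁻ x, (1 - ψ x) ∂ν) := by
        simp_rw [hX.lintegral_eexpNeg_tsum v hv, eexpNeg_v]
    _ = eexpNeg (∫⁻ q, (1 - eexpNeg (u q)) ∂(ν ⊗ₘ κ)) := by
        rw [Measure.lintegral_compProd (by fun_prop)]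
        exact congrArg eexpNeg (lintegral_congr fun x =>
          (lintegral_one_sub_eexpNeg (hu.comp measurable_prodMk_left)).symm)

end Marking

lemma one_sub_inv_one_add_pow_le {x : ℝ} (hx : 0 ≤ x) (n : ℕ) :
    1 - ((1 + x) ^ n)⁻¹ ≤ n * x := by
  have inv_nonneg : 0 ≤ (1 + x)⁻¹ := by positivity
  have one_sub_inv_le : 1 - (1 + x)⁻¹ ≤ x := by
    have := Real.one_sub_inv_le_log_of_pos (x := 1 + x) (by positivity)
    linarith [Real.log_le_sub_one_of_pos (x := 1 + x) (by positivity)]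
  have bernoulli := one_add_mul_sub_le_pow (a := (1 + x)⁻¹) (by linarith) n
  rw [← inv_pow]
  nlinarith [mul_le_mul_of_nonneg_left one_sub_inv_le n.cast_nonneg]

lemma ofReal_sum_sum_sum_of_nonneg {α β γ : Type*} [Fintype α] [Fintype β] [Fintype γ]
    {f : α → β → γ → ℝ} (hf : ∀ a b c, 0 ≤ f a b c) :
    ENNReal.ofReal (∑ a, ∑ b, ∑ c, f a b c) = ∑ a, ∑ b, ∑ c, ENNReal.ofReal (f a b c) := by
  rw [ENNReal.ofReal_sum_of_nonneg fun a _ => Finset.sum_nonneg fun b _ =>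
    Finset.sum_nonneg fun c _ => hf a b c]
  simp_rw [ENNReal.ofReal_sum_of_nonneg fun b _ => Finset.sum_nonneg fun c _ => hf _ b c,
    ENNReal.ofReal_sum_of_nonneg fun c _ => hf _ _ c]

namespace Params

variable (p : Params) (t₁ : TxKind) (t₂ : RxKind)

lemma nak_cast_pos (k : Status) : (0 : ℝ) < p.nak k := by
  cases k
  · exact_mod_cast p.nak_pos.trans p.nak_lt
  · exact_mod_cast p.nak_pos

lemma lobeProb_nonneg {θ : ℝ} (hθ : θ ∈ Icc 0 (2 * Real.pi)) (i : Lobe) : 0 ≤ lobeProb θ i := by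
  cases i
  · exact div_nonneg hθ.1 Real.two_pi_pos.le
  · exact div_nonneg (sub_nonneg.2 hθ.2) Real.two_pi_pos.le

lemma sum_lobeProb (θ : ℝ) : ∑ i, lobeProb θ i = 1 := by
  have hsum : ∑ i, lobeProb θ i = θ / (2 * Real.pi) + (2 * Real.pi - θ) / (2 * Real.pi) :=
    Finset.sum_pair (by decide)
  rw [hsum, ← add_div, add_sub_cancel, div_self Real.two_pi_pos.ne']

lemma gainProb_nonneg (i j : Lobe) : 0 ≤ p.gainProb t₁ t₂ i j :=
  mul_nonneg (lobeProb_nonneg (p.txWidth_mem t₁) i) (lobeProb_nonneg (p.rxWidth_mem t₂) j)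

lemma statusProb_nonneg {r : ℝ} (hr : 0 ≤ r) (k : Status) : 0 ≤ p.statusProb r k := by
  cases k
  · exact (Real.exp_pos _).le
  · exact sub_nonneg.2 (Real.exp_le_one_iff.2 (by nlinarith [p.beta_pos]))

lemma sum_statusProb (r : ℝ) : ∑ k, p.statusProb r k = 1 := by
  have hsum : ∑ k, p.statusProb r k = Real.exp (-p.beta * r) + (1 - Real.exp (-p.beta * r)) :=
    Finset.sum_pair (by decide)
  rw [hsum, add_sub_cancel]

lemma statusProb_le_one {r : ℝ} (hr : 0 ≤ r) (k : Status) : p.statusProb r k ≤ 1 :=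
  p.sum_statusProb r ▸ Finset.single_le_sum (fun k _ => p.statusProb_nonneg hr k)
    (Finset.mem_univ k)

lemma statusProb_mul_gainProb_nonneg {r : ℝ} (hr : 0 ≤ r) (k : Status) (i j : Lobe) :
    0 ≤ p.statusProb r k * p.gainProb t₁ t₂ i j :=
  mul_nonneg (p.statusProb_nonneg hr k) (p.gainProb_nonneg t₁ t₂ i j)

lemma sum_statusProb_mul_gainProb (r : ℝ) :
    ∑ k, ∑ i, ∑ j, p.statusProb r k * p.gainProb t₁ t₂ i j = 1 := by
  simp_rw [gainProb, ← Finset.mul_sum, sum_lobeProb, mul_one, sum_lobeProb, mul_one,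
    sum_statusProb]

@[fun_prop]
lemma measurable_statusProb (k : Status) : Measurable fun r => p.statusProb r k := by
  cases k <;> simp only [statusProb] <;> fun_prop

instance (k : Status) : IsProbabilityMeasure (gammaMeasure (p.nak k) (p.nak k)) :=
  isProbabilityMeasure_gammaMeasure (p.nak_cast_pos k) (p.nak_cast_pos k)

lemma lintegral_linkLaw (r : ℝ) {f : Link → ℝ≥0∞} (hf : Measurable f) :
    ∫⁻ l, f l ∂(p.linkLaw t₁ t₂ r) =
      ∑ k, ∑ i, ∑ j, ENNReal.ofReal (p.statusProb r k * p.gainProb t₁ t₂ i j) *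
        ∫⁻ h, f ((k, i, j), h) ∂(gammaMeasure (p.nak k) (p.nak k)) := by
  simp_rw [linkLaw, lintegral_finsetSum_measure, lintegral_smul_measure, smul_eq_mul,
    Measure.dirac_prod, lintegral_map hf measurable_prodMk_left]

lemma isProbabilityMeasure_linkLaw {r : ℝ} (hr : 0 ≤ r) :
    IsProbabilityMeasure (p.linkLaw t₁ t₂ r) := by
  refine ⟨?_⟩
  rw [← lintegral_one, p.lintegral_linkLaw t₁ t₂ r (f := fun _ => 1) measurable_const]
  simp_rw [lintegral_one, measure_univ, mul_one]
  rw [← ofReal_sum_sum_sum_of_nonneg (p.statusProb_mul_gainProb_nonneg t₁ t₂ hr),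
    sum_statusProb_mul_gainProb, ENNReal.ofReal_one]

/-- The law of the state of a link between a node at a variable location `x` and a node at the
fixed location `y`, as a kernel in `x`. -/
noncomputable def linkKernel (y : Plane) : Kernel Plane Link where
  toFun x := p.linkLaw t₁ t₂ (dist x y)
  measurable' := by
    refine Measure.measurable_of_measurable_coe _ fun A hA => ?_
    simp_rw [← lintegral_indicator_one hA,
      p.lintegral_linkLaw t₁ t₂ _ (measurable_one.indicator hA)]
    fun_prop

instance (y : Plane) : IsMarkovKernel (p.linkKernel t₁ t₂ y) :=
  ⟨fun _ => p.isProbabilityMeasure_linkLaw t₁ t₂ dist_nonneg⟩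

lemma measurable_receivedPower : Measurable fun q : ℝ × Link => p.receivedPower t₁ t₂ q.1 q.2 := by
  have uncurried : Measurable fun q : (Status × Lobe × Lobe) × (ℝ × ℝ) =>
      p.receivedPower t₁ t₂ q.2.1 (q.1, q.2.2) := by
    refine measurable_from_prod_countable_right fun a => ?_
    simp only [receivedPower, antennaGain]
    fun_prop
  exact uncurried.comp (by fun_prop : Measurable fun q : ℝ × Link => (q.2.1, q.1, q.2.2))

/-- The Laplace transform at `s` of the power received over distance `r` on a link of status `k`
seen through the lobes `i` and `j`; only the channel gain is random. -/
noncomputable def linkLaplace (k : Status) (i j : Lobe) (s r : ℝ) : ℝ :=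
  ((1 + s * p.power t₁ * p.txGain t₁ i * p.rxGain t₂ j / (p.nak k * r ^ p.alpha k)) ^ p.nak k)⁻¹

lemma OmegaKIJ_eq_mul_one_sub_linkLaplace (k : Status) (i j : Lobe) (s r : ℝ) :
    p.OmegaKIJ t₁ t₂ k i j s r =
      p.statusProb r k * p.gainProb t₁ t₂ i j * (1 - p.linkLaplace t₁ t₂ k i j s r) := by
  rw [OmegaKIJ, linkLaplace, zpow_neg, zpow_natCast, mul_comm (p.gainProb t₁ t₂ i j)]

@[fun_prop]
lemma measurable_linkLaplace (k : Status) (i j : Lobe) (s : ℝ) :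
    Measurable fun r => p.linkLaplace t₁ t₂ k i j s r := by
  unfold linkLaplace
  fun_prop

lemma mul_power_mul_gain_nonneg {s : ℝ} (hs : 0 ≤ s) (i j : Lobe) :
    0 ≤ s * p.power t₁ * p.txGain t₁ i * p.rxGain t₂ j :=
  mul_nonneg (mul_nonneg (mul_nonneg hs (p.power_pos t₁).le) (p.txGain_pos t₁ i).le)
    (p.rxGain_pos t₂ j).le

lemma linkLaplace_mem_Icc {s r : ℝ} (hs : 0 ≤ s) (hr : 0 ≤ r) (k : Status) (i j : Lobe) :
    p.linkLaplace t₁ t₂ k i j s r ∈ Icc 0 1 := by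
  have := p.mul_power_mul_gain_nonneg t₁ t₂ hs i j
  exact ⟨by unfold linkLaplace; positivity,
    inv_le_one_of_one_le₀ (one_le_pow₀ (le_add_of_nonneg_right (by positivity)))⟩

lemma one_sub_linkLaplace_le {s r : ℝ} (hs : 0 ≤ s) (hr : 0 ≤ r) (k : Status) (i j : Lobe) :
    1 - p.linkLaplace t₁ t₂ k i j s r ≤
      s * p.power t₁ * p.txGain t₁ i * p.rxGain t₂ j * r ^ (-p.alpha k) := by
  have := p.mul_power_mul_gain_nonneg t₁ t₂ hs i j
  refine (one_sub_inv_one_add_pow_le (by positivity) _).trans_eq ?_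
  rw [mul_div_assoc', mul_div_mul_left _ _ (p.nak_cast_pos k).ne', Real.rpow_neg hr, div_eq_mul_inv]

lemma lintegral_eexpNeg_receivedPower_gammaMeasure {s r : ℝ} (hs : 0 ≤ s) (hr : 0 ≤ r)
    (k : Status) (i j : Lobe) :
    ∫⁻ h, eexpNeg (ENNReal.ofReal s * ENNReal.ofReal (p.receivedPower t₁ t₂ r ((k, i, j), h)))
        ∂(gammaMeasure (p.nak k) (p.nak k)) =
      ENNReal.ofReal (p.linkLaplace t₁ t₂ k i j s r) := by
  have hN := p.nak_cast_pos k
  have hgain := p.mul_power_mul_gain_nonneg t₁ t₂ hs i j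
  have hpower (h : ℝ) : s * p.receivedPower t₁ t₂ r ((k, i, j), h) =
      s * p.power t₁ * p.txGain t₁ i * p.rxGain t₂ j / r ^ p.alpha k * h := by
    rw [receivedPower, antennaGain, Real.rpow_neg hr]
    ring
  simp_rw [← ENNReal.ofReal_mul hs, hpower]
  rw [lintegral_eexpNeg_gammaMeasure hN hN (by positivity), Real.rpow_natCast, linkLaplace,
    ← inv_pow, mul_comm (p.nak k : ℝ), ← div_div, one_add_div hN.ne', inv_div]

lemma OmegaKIJ_nonneg {s r : ℝ} (hs : 0 ≤ s) (hr : 0 ≤ r) (k : Status) (i j : Lobe) :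
    0 ≤ p.OmegaKIJ t₁ t₂ k i j s r := by
  rw [OmegaKIJ_eq_mul_one_sub_linkLaplace]
  exact mul_nonneg (p.statusProb_mul_gainProb_nonneg t₁ t₂ hr k i j)
    (sub_nonneg.2 (p.linkLaplace_mem_Icc t₁ t₂ hs hr k i j).2)

lemma Omega_nonneg {s r : ℝ} (hs : 0 ≤ s) (hr : 0 ≤ r) : 0 ≤ p.Omega t₁ t₂ s r :=
  Finset.sum_nonneg fun k _ => Finset.sum_nonneg fun i _ => Finset.sum_nonneg fun j _ =>
    p.OmegaKIJ_nonneg t₁ t₂ hs hr k i j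

@[fun_prop]
lemma measurable_OmegaKIJ (k : Status) (i j : Lobe) (s : ℝ) :
    Measurable fun r => p.OmegaKIJ t₁ t₂ k i j s r := by
  simp_rw [OmegaKIJ_eq_mul_one_sub_linkLaplace]
  fun_prop

lemma measurable_Omega (s : ℝ) : Measurable fun r => p.Omega t₁ t₂ s r := by
  unfold Omega OmegaK
  fun_prop

theorem lintegral_one_sub_eexpNeg_receivedPower {s r : ℝ} (hs : 0 ≤ s) (hr : 0 ≤ r) :
    ∫⁻ l, (1 - eexpNeg (ENNReal.ofReal s * ENNReal.ofReal (p.receivedPower t₁ t₂ r l)))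
      ∂(p.linkLaw t₁ t₂ r) = ENNReal.ofReal (p.Omega t₁ t₂ s r) := by
  have hpower : Measurable fun l => p.receivedPower t₁ t₂ r l :=
    (p.measurable_receivedPower t₁ t₂).comp measurable_prodMk_left
  simp_rw [Omega, OmegaK]
  rw [p.lintegral_linkLaw t₁ t₂ r (by fun_prop),
    ofReal_sum_sum_sum_of_nonneg (p.OmegaKIJ_nonneg t₁ t₂ hs hr)]
  congr! with k _ i _ j _
  rw [lintegral_one_sub_eexpNeg (by fun_prop),
    p.lintegral_eexpNeg_receivedPower_gammaMeasure t₁ t₂ hs hr, ← ENNReal.ofReal_one,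
    ← ENNReal.ofReal_sub _ (p.linkLaplace_mem_Icc t₁ t₂ hs hr k i j).1,
    ← ENNReal.ofReal_mul (p.statusProb_mul_gainProb_nonneg t₁ t₂ hr k i j),
    OmegaKIJ_eq_mul_one_sub_linkLaplace]

lemma integrableOn_one_sub_linkLaplace_mul {k : Status} (hk : 2 < p.alpha k) (i j : Lobe) {s : ℝ}
    (hs : 0 ≤ s) : IntegrableOn (fun r => (1 - p.linkLaplace t₁ t₂ k i j s r) * r) (Ioi 0) := by
  have hm : Measurable fun r => (1 - p.linkLaplace t₁ t₂ k i j s r) * r := by fun_prop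
  have norm_eq {r : ℝ} (hr : 0 < r) : ‖(1 - p.linkLaplace t₁ t₂ k i j s r) * r‖ =
      (1 - p.linkLaplace t₁ t₂ k i j s r) * r :=
    Real.norm_of_nonneg
      (mul_nonneg (sub_nonneg.2 (p.linkLaplace_mem_Icc t₁ t₂ hs hr.le k i j).2) hr.le)
  rw [← Ioc_union_Ioi_eq_Ioi zero_le_one]
  refine IntegrableOn.union ?_ ?_
  · refine Integrable.mono' (g := fun _ => 1) (by simp) hm.aestronglyMeasurable
      ((ae_restrict_mem measurableSet_Ioc).mono fun r hr => ?_)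
    rw [norm_eq hr.1]
    exact mul_le_one₀ (sub_le_self _ (p.linkLaplace_mem_Icc t₁ t₂ hs hr.1.le k i j).1) hr.1.le hr.2
  · refine Integrable.mono' ((integrableOn_Ioi_rpow_of_lt (a := -p.alpha k + 1) (by linarith)
      zero_lt_one).const_mul (s * p.power t₁ * p.txGain t₁ i * p.rxGain t₂ j))
      hm.aestronglyMeasurable ((ae_restrict_mem measurableSet_Ioi).mono fun r hr => ?_)
    have hr0 : 0 < r := zero_lt_one.trans hr
    rw [norm_eq hr0, Real.rpow_add hr0, Real.rpow_one, ← mul_assoc]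
    exact mul_le_mul_of_nonneg_right (p.one_sub_linkLaplace_le t₁ t₂ hs hr0.le k i j) hr0.le

lemma integrableOn_exp_neg_beta_mul :
    IntegrableOn (fun r => Real.exp (-p.beta * r) * r) (Ioi 0) := by
  simpa [mul_comm] using
    integrableOn_rpow_mul_exp_neg_mul_rpow (s := 1) (by norm_num) zero_lt_one p.beta_pos

lemma integrableOn_OmegaKIJ_mul (hα : 2 < p.alpha Status.NLoS) (k : Status) (i j : Lobe) {s : ℝ}
    (hs : 0 ≤ s) : IntegrableOn (fun r => p.OmegaKIJ t₁ t₂ k i j s r * r) (Ioi 0) := by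
  have hm : Measurable fun r => p.OmegaKIJ t₁ t₂ k i j s r * r := by fun_prop
  have of_bound {g : ℝ → ℝ} (hg : IntegrableOn g (Ioi 0)) (hle : ∀ r, 0 < r →
      p.statusProb r k * (1 - p.linkLaplace t₁ t₂ k i j s r) * r ≤ g r) :
      IntegrableOn (fun r => p.OmegaKIJ t₁ t₂ k i j s r * r) (Ioi 0) := by
    refine Integrable.mono' (hg.const_mul (p.gainProb t₁ t₂ i j)) hm.aestronglyMeasurable
      ((ae_restrict_mem measurableSet_Ioi).mono fun r (hr : 0 < r) => ?_)
    rw [Real.norm_of_nonneg (mul_nonneg (p.OmegaKIJ_nonneg t₁ t₂ hs hr.le k i j) hr.le),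
      OmegaKIJ_eq_mul_one_sub_linkLaplace, mul_comm (p.statusProb r k), mul_assoc, mul_assoc,
      ← mul_assoc (p.statusProb r k)]
    exact mul_le_mul_of_nonneg_left (hle r hr) (p.gainProb_nonneg t₁ t₂ i j)
  cases k with
  | LoS =>
    refine of_bound p.integrableOn_exp_neg_beta_mul fun r hr => ?_
    have := (p.linkLaplace_mem_Icc t₁ t₂ hs hr.le Status.LoS i j).1
    exact mul_le_mul_of_nonneg_right
      (mul_le_of_le_one_right (p.statusProb_nonneg hr.le _) (by linarith)) hr.le
  | NLoS =>
    refine of_bound (p.integrableOn_one_sub_linkLaplace_mul t₁ t₂ hα i j hs) fun r hr => ?_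
    have := (p.linkLaplace_mem_Icc t₁ t₂ hs hr.le Status.NLoS i j).2
    exact mul_le_mul_of_nonneg_right
      (mul_le_of_le_one_left (by linarith) (p.statusProb_le_one hr.le _)) hr.le

theorem integrableOn_Omega_mul (hα : 2 < p.alpha Status.NLoS) {s : ℝ} (hs : 0 ≤ s) :
    IntegrableOn (fun r => p.Omega t₁ t₂ s r * r) (Ioi 0) := by
  simp_rw [Omega, OmegaK, Finset.sum_mul]
  exact integrable_finsetSum _ fun k _ => integrable_finsetSum _ fun i _ =>
    integrable_finsetSum _ fun j _ => p.integrableOn_OmegaKIJ_mul t₁ t₂ hα k i j hs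

end Params

lemma lintegral_fun_norm_addHaar {E : Type*} [NormedAddCommGroup E] [NormedSpace ℝ E]
    [MeasurableSpace E] [BorelSpace E] [FiniteDimensional ℝ E] [Nontrivial E] (μ : Measure E)
    [μ.IsAddHaarMeasure] {f : ℝ → ℝ≥0∞} (hf : Measurable f) :
    ∫⁻ x, f ‖x‖ ∂μ = Module.finrank ℝ E * μ (Metric.ball 0 1) *
      ∫⁻ r in Ioi (0 : ℝ), ENNReal.ofReal (r ^ (Module.finrank ℝ E - 1)) * f r := by
  have hcompl : MeasurableSet ({(0 : E)}ᶜ) := (measurableSet_singleton _).compl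
  have hf_radius : Measurable fun r : Ioi (0 : ℝ) => f r := hf.comp measurable_subtype_coe
  have hf_polar : Measurable fun y : Metric.sphere (0 : E) 1 × Ioi (0 : ℝ) => f y.2 :=
    hf_radius.comp measurable_snd
  calc ∫⁻ x, f ‖x‖ ∂μ = ∫⁻ x in {(0 : E)}ᶜ, f ‖x‖ ∂μ := by rw [restrict_compl_singleton]
    _ = ∫⁻ x : ({(0 : E)}ᶜ : Set E), f ‖x.1‖ ∂(μ.comap (↑)) :=
        (lintegral_subtype_comap hcompl fun x => f ‖x‖).symm
    _ = ∫⁻ y, f y.2 ∂(μ.toSphere.prod (Measure.volumeIoiPow (Module.finrank ℝ E - 1))) := by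
        rw [← μ.measurePreserving_homeomorphUnitSphereProd.lintegral_comp hf_polar]
        simp
    _ = μ.toSphere univ * ∫⁻ r, f r ∂(Measure.volumeIoiPow (Module.finrank ℝ E - 1)) := by
        simp_rw [lintegral_prod _ hf_polar.aemeasurable, lintegral_const, mul_comm]
    _ = _ := by
        rw [Measure.toSphere_apply_univ, Measure.volumeIoiPow,
          lintegral_withDensity_eq_lintegral_mul _ (by fun_prop) hf_radius]
        congr 1
        exact lintegral_subtype_comap (μ := volume) measurableSet_Ioi
          fun r => ENNReal.ofReal (r ^ (Module.finrank ℝ E - 1)) * f r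

lemma lintegral_dist_plane (y : Plane) {f : ℝ → ℝ≥0∞} (hf : Measurable f) :
    ∫⁻ x : Plane, f (dist x y) =
      ENNReal.ofReal (2 * Real.pi) * ∫⁻ r in Ioi (0 : ℝ), f r * ENNReal.ofReal r := by
  simp_rw [dist_eq_norm]
  rw [lintegral_sub_right_eq_self (fun x : Plane => f ‖x‖) y, lintegral_fun_norm_addHaar volume hf,
    EuclideanSpace.volume_ball_fin_two, finrank_euclideanSpace_fin]
  simp only [Nat.cast_ofNat, Nat.add_one_sub_one, pow_one, mul_comm (f _)]
  congr 1
  rw [ENNReal.ofReal_mul zero_le_two]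
  simp

namespace Params

variable (p : Params) (t₁ : TxKind) (t₂ : RxKind)

lemma measurable_receivedPower_dist (y : Plane) :
    Measurable fun q : Plane × Link => p.receivedPower t₁ t₂ (dist q.1 y) q.2 :=
  (p.measurable_receivedPower t₁ t₂).comp
    (by fun_prop : Measurable fun q : Plane × Link => (dist q.1 y, q.2))

theorem lintegral_one_sub_eexpNeg_receivedPower_compProd (y : Plane) {lam : ℝ} (hlam : 0 ≤ lam)
    {s : ℝ} (hs : 0 ≤ s) :
    ∫⁻ q, (1 - eexpNeg (ENNReal.ofReal s *
        ENNReal.ofReal (p.receivedPower t₁ t₂ (dist q.1 y) q.2)))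
        ∂((ENNReal.ofReal lam • volume) ⊗ₘ p.linkKernel t₁ t₂ y) =
      ENNReal.ofReal (2 * Real.pi * lam) *
        ∫⁻ r in Ioi (0 : ℝ), ENNReal.ofReal (p.Omega t₁ t₂ s r * r) := by
  have : SigmaFinite (ENNReal.ofReal lam • (volume : Measure Plane)) :=
    SMul.sigmaFinite lam.toNNReal
  have hpower := p.measurable_receivedPower_dist t₁ t₂ y
  have hOmega : Measurable fun r => ENNReal.ofReal (p.Omega t₁ t₂ s r) :=
    (p.measurable_Omega t₁ t₂ s).ennreal_ofReal
  calc
    _ = ∫⁻ x, ENNReal.ofReal (p.Omega t₁ t₂ s (dist x y)) ∂(ENNReal.ofReal lam • volume) := by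
      rw [Measure.lintegral_compProd (by fun_prop)]
      exact lintegral_congr fun x =>
        p.lintegral_one_sub_eexpNeg_receivedPower t₁ t₂ hs dist_nonneg
    _ = ENNReal.ofReal (2 * Real.pi * lam) *
        ∫⁻ r in Ioi (0 : ℝ), ENNReal.ofReal (p.Omega t₁ t₂ s r) * ENNReal.ofReal r := by
      rw [lintegral_smul_measure, lintegral_dist_plane y hOmega, smul_eq_mul, ← mul_assoc,
        ← ENNReal.ofReal_mul hlam, mul_comm lam]
    _ = _ := by
      congr 1
      exact setLIntegral_congr_fun measurableSet_Ioi fun r (hr : 0 < r) =>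
        (ENNReal.ofReal_mul' hr.le).symm

lemma expNeg_mul_lintegral_Omega {s lam : ℝ} (hs : 0 ≤ s) (hlam : 0 ≤ lam)
    (hΩ : IntegrableOn (fun r => p.Omega t₁ t₂ s r * r) (Ioi 0)) :
    expNeg (ENNReal.ofReal (2 * Real.pi * lam) *
        ∫⁻ r in Ioi (0 : ℝ), ENNReal.ofReal (p.Omega t₁ t₂ s r * r)) =
      Real.exp (-2 * Real.pi * lam * ∫ r in Ioi (0 : ℝ), p.Omega t₁ t₂ s r * r) := by
  have integrand_nonneg (r : ℝ) (hr : r ∈ Ioi (0 : ℝ)) : 0 ≤ p.Omega t₁ t₂ s r * r :=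
    mul_nonneg (p.Omega_nonneg t₁ t₂ hs (mem_Ioi.1 hr).le) (mem_Ioi.1 hr).le
  have hcoef : 0 ≤ 2 * Real.pi * lam := mul_nonneg Real.two_pi_pos.le hlam
  rw [← ofReal_integral_eq_lintegral_ofReal hΩ
      ((ae_restrict_mem measurableSet_Ioi).mono integrand_nonneg), ← ENNReal.ofReal_mul hcoef,
    expNeg_ofReal (mul_nonneg hcoef (setIntegral_nonneg measurableSet_Ioi integrand_nonneg))]
  congr 1
  ring

end Params

section Interference

variable {Ω : Type*} {mΩ : MeasurableSpace Ω} {P : Measure Ω}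
  {p : Params} {t₁ : TxKind} {t₂ : RxKind} {y : Plane} {lam s : ℝ} {X : ℕ → Ω → Plane}
  {Y : ℕ → Ω → Link}

lemma laplaceTransform_tsum_receivedPower (hlam : 0 ≤ lam) (hs : 0 ≤ s)
    (hXY : HasPoissonLaplaceFunctional P ((ENNReal.ofReal lam • volume) ⊗ₘ p.linkKernel t₁ t₂ y)
      fun n ω => (X n ω, Y n ω)) :
    laplaceTransform P
        (fun ω => ∑' n, ENNReal.ofReal (p.receivedPower t₁ t₂ (dist (X n ω) y) (Y n ω))) s =
      expNeg (ENNReal.ofReal (2 * Real.pi * lam) *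
        ∫⁻ r in Ioi (0 : ℝ), ENNReal.ofReal (p.Omega t₁ t₂ s r * r)) := by
  let f : Plane × Link → ℝ≥0∞ := fun q =>
    ENNReal.ofReal (p.receivedPower t₁ t₂ (dist q.1 y) q.2)
  have hf : Measurable f := (p.measurable_receivedPower_dist t₁ t₂ y).ennreal_ofReal
  have hsum : Measurable fun ω => ∑' n, f (X n ω, Y n ω) :=
    Measurable.tsum fun n => hf.comp (hXY.measurable n)
  calc
    _ = (∫⁻ ω, eexpNeg (∑' n, ENNReal.ofReal s * f (X n ω, Y n ω)) ∂P).toReal := by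
      simp_rw [ENNReal.tsum_mul_left]
      exact (toReal_lintegral_eexpNeg hsum s).symm
    _ = (eexpNeg (∫⁻ q, (1 - eexpNeg (ENNReal.ofReal s * f q))
        ∂((ENNReal.ofReal lam • volume) ⊗ₘ p.linkKernel t₁ t₂ y))).toReal := by
      rw [hXY.lintegral_eexpNeg_tsum (fun q => ENNReal.ofReal s * f q) (by fun_prop)]
    _ = _ := by
      rw [p.lintegral_one_sub_eexpNeg_receivedPower_compProd t₁ t₂ y hlam hs, toReal_eexpNeg]

lemma ae_tsum_receivedPower_lt_top [IsProbabilityMeasure P] (hlam : 0 ≤ lam)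
    (hα : 2 < p.alpha Status.NLoS)
    (hXY : HasPoissonLaplaceFunctional P ((ENNReal.ofReal lam • volume) ⊗ₘ p.linkKernel t₁ t₂ y)
      fun n ω => (X n ω, Y n ω)) :
    ∀ᵐ ω ∂P, ∑' n, ENNReal.ofReal (p.receivedPower t₁ t₂ (dist (X n ω) y) (Y n ω)) < ∞ := by
  refine hXY.ae_tsum_lt_top (p.measurable_receivedPower_dist t₁ t₂ y).ennreal_ofReal
    (fun _ => ENNReal.ofReal_ne_top) ?_
  have hint := p.lintegral_one_sub_eexpNeg_receivedPower_compProd t₁ t₂ y hlam zero_le_one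
  simp_rw [ENNReal.ofReal_one, one_mul] at hint
  rw [hint]
  exact ENNReal.mul_ne_top ENNReal.ofReal_ne_top
    (p.integrableOn_Omega_mul t₁ t₂ hα zero_le_one).lintegral_lt_top.ne

end Interference

namespace Network

variable {Ω : Type*} (net : Network Ω)

lemma measurable_tx_locSigma (n : ℕ) : Measurable[net.locSigma] (net.tx n) := by
  have hloc : Measurable[net.locSigma] net.locations := comap_measurable _
  exact (measurable_pi_apply n).comp hloc.fst.fst.fst

lemma IsModel.measurable_locations {net : Network Ω} [MeasurableSpace Ω] {P : Measure Ω}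
    {p : Params} (hmodel : net.IsModel p P) : Measurable net.locations :=
  (((measurable_pi_lambda _ hmodel.poisson_tx.measurable).prodMk
    (measurable_pi_lambda _ hmodel.poisson_rx.measurable)).prodMk
    (measurable_pi_lambda _ hmodel.poisson_eve.measurable)).prodMk hmodel.measurable_angle

end Network

end OWJ

theorem mainTheorem12_general {Ω : Type*} {m mΩ : MeasurableSpace Ω} (P : Measure Ω)
    [IsProbabilityMeasure P] (p : OWJ.Params) (t₁ : OWJ.TxKind) (t₂ : OWJ.RxKind) (y : OWJ.Plane)
    {lam : ℝ} (hlam : 0 ≤ lam) (hm : m ≤ mΩ) {X : ℕ → Ω → OWJ.Plane}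
    {Y : ℕ → Ω → OWJ.Link} (hX : OWJ.IsPoissonProcess P (ENNReal.ofReal lam • volume) X)
    (hXm : ∀ n, Measurable[m] (X n)) (hY : ∀ n, Measurable (Y n))
    (hYX : OWJ.IsCondIndepWithLaw P m Y fun n ω => p.linkLaw t₁ t₂ (dist (X n ω) y))
    {s : ℝ} (hs : 0 ≤ s) :
    let I : Ω → ℝ≥0∞ := fun ω =>
      ∑' n, ENNReal.ofReal (p.receivedPower t₁ t₂ (dist (X n ω) y) (Y n ω))
    OWJ.laplaceTransform P I s = OWJ.expNeg (ENNReal.ofReal (2 * Real.pi * lam) *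
        ∫⁻ r in Ioi (0 : ℝ), ENNReal.ofReal (p.Omega t₁ t₂ s r * r)) ∧
      (2 < p.alpha OWJ.Status.NLoS →
        (∀ᵐ ω ∂P, I ω < ∞) ∧
        IntegrableOn (fun r => p.Omega t₁ t₂ s r * r) (Ioi 0) ∧
        ∫ ω, Real.exp (-s * (I ω).toReal) ∂P =
          Real.exp (-2 * Real.pi * lam * ∫ r in Ioi (0 : ℝ), p.Omega t₁ t₂ s r * r)) := by
  intro I
  have : SigmaFinite (ENNReal.ofReal lam • (volume : Measure OWJ.Plane)) :=
    SMul.sigmaFinite lam.toNNReal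
  have marked : OWJ.HasPoissonLaplaceFunctional P
      ((ENNReal.ofReal lam • volume) ⊗ₘ p.linkKernel t₁ t₂ y) fun n ω => (X n ω, Y n ω) :=
    hX.hasPoissonLaplaceFunctional.prodMk hm hXm hY hYX
  have laplace := OWJ.laplaceTransform_tsum_receivedPower hlam hs marked
  refine ⟨laplace, fun hα => ?_⟩
  have finite := OWJ.ae_tsum_receivedPower_lt_top hlam hα marked
  have integrable := p.integrableOn_Omega_mul t₁ t₂ hα hs
  refine ⟨finite, integrable, ?_⟩
  rw [← OWJ.laplaceTransform_eq_integral_exp finite hs, laplace,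
    p.expNeg_mul_lintegral_Omega t₁ t₂ hs hlam integrable]

theorem mainTheorem12 {Ω : Type*} [MeasurableSpace Ω] (P : Measure Ω) [IsProbabilityMeasure P]
    (p : OWJ.Params) (net : OWJ.Network Ω) (hmodel : net.IsModel p P)
    (a : OWJ.Attack) (s : ℝ) (hs : 0 ≤ s) :
    OWJ.laplaceTransform P (net.interference p a OWJ.TxKind.T) s =
        OWJ.expNeg (ENNReal.ofReal (2 * Real.pi * p.lam) *
          ∫⁻ r in Ioi (0 : ℝ), ENNReal.ofReal (p.Omega OWJ.TxKind.T OWJ.RxKind.R s r * r)) ∧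
      (2 < p.alpha OWJ.Status.NLoS →
        (∀ᵐ ω ∂P, net.interference p a OWJ.TxKind.T ω < ∞) ∧
        IntegrableOn (fun r => p.Omega OWJ.TxKind.T OWJ.RxKind.R s r * r) (Ioi 0) ∧
        ∫ ω, Real.exp (-s * (net.interference p a OWJ.TxKind.T ω).toReal) ∂P =
          Real.exp (-2 * Real.pi * p.lam *
            ∫ r in Ioi (0 : ℝ), p.Omega OWJ.TxKind.T OWJ.RxKind.R s r * r)) :=
  mainTheorem12_general P p OWJ.TxKind.T OWJ.RxKind.R net.y₀ p.lam_pos.le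
    hmodel.measurable_locations.comap_le hmodel.poisson_tx net.measurable_tx_locSigma
    hmodel.measurable_linkTY hmodel.linkTY_law hs
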